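/- **Setting.** Let $\mu$ be a $\sigma$-finite Borel measure on $E=\mathbb R^k$, let $\Theta\subseteq\mathbb R^m$ be an open set homeomorphic to $\mathbb R^m$, and let $M=\{f(x,\theta)\mid\theta\in\Theta\}$ be a family of probability densities with respect to $\mu$. Write $l(x,\theta)=\log f(x,\theta)$, $\partial_i=\partial/\partial\theta^i$ and $\langle r\rangle_\theta=\int_E r(x)f(x,\theta)\,d\mu(x)$; repeated indices are summed. Let $R_\theta$ be the space of random variables $r$ with $\langle r\rangle_\theta=0$ and $\langle r^2\rangle_\theta<\infty$, and put $$g_{ij}(\theta)=\langle\partial_il\,\partial_jl\rangle_\theta,\qquad \Gamma^{(1)}_{ijk}(\theta)=\langle\partial_i\partial_jl\,\partial_kl\rangle_\theta,\qquad \Gamma^{(1)k}_{ij}=\Gamma^{(1)}_{ijl}\,g^{lk},$$ where $(g^{lk})$ is the inverse matrix of $(g_{ij})$. Assume that $M$ is a statistical manifold, that is: for $\mu$-almost every $x$, $f(x,\cdot)$ is positive and $C^\infty$ on $\Theta$; distinct parameters give densities that are not $\mu$-a.e. equal; for every $\theta\in\Theta$ and all $i,j$, the functions $\partial_il(\cdot,\theta)$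 and $\partial_i\partial_jl(\cdot,\theta)+g_{ij}(\theta)$ belong to $R_\theta$; and the matrix $(g_{ij}(\theta))$ is positive definite for every $\theta\in\Theta$. **Definition.** $M$ is a full regular minimally represented exponential family if there are a $C^\infty$ diffeomorphism $\theta\mapsto\xi(\theta)$ from $\Theta$ onto an open set $\Xi\subseteq\mathbb R^m$ (the natural parameter), measurable functions $l_0:E\to\mathbb R$ and $t=(t_1,\dots,t_m):E\to\mathbb R^m$ (the canonical statistic), and a real function $\psi$ that is $C^\infty$ on $\Xi$ and convex on the convex hull of $\Xi$, such that for $\mu$-almost every $x$ $$f(x,\theta)=\exp\{\,l_0(x)+\xi^a(\theta)\,t_a(x)-\psi(\xi(\theta))\,\}\qquad\text{for all }\theta\in\Theta,$$ where $1,t_1,\dots,t_m$ are linearly independent modulo $\mu$-null functions, and $\langle t_a\rangle_\theta$ exists and equals $(\partial\psi/\partial\xi^a)(\xi(\theta))$ for all $\theta\in\Theta$ and all $a$ (the expectation parameter). **Theorem 3.1.** The statistical manifold $M=\{f(x,\theta)\mid\theta\in\Theta\}$ is a full regular minimally represented exponential family if and only if its $1$-Euler–Schouten curvature tensor variable vanishes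 identically: for $\mu$-almost every $x$, $$h^{(1)}_{ij}(x,\theta)=\partial_i\partial_jl(x,\theta)+g_{ij}(\theta)-\Gamma^{(1)k}_{ij}(\theta)\,\partial_kl(x,\theta)=0\qquad\text{for all }\theta\in\Theta\text{ and all }i,j.$$ -/

import Mathlib

open MeasureTheory
open scoped ContDiff

noncomputable section

namespace StatManifold

variable {E : Type*} {m : ℕ}

/-- The partial derivative `∂u/∂θ^i` of a real function on (an open subset of) `ℝ^m`. -/
def pd (i : Fin m) (u : EuclideanSpace ℝ (Fin m) → ℝ) (θ : EuclideanSpace ℝ (Fin m)) : ℝ :=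
  fderiv ℝ u θ (EuclideanSpace.single i 1)

/-- The log-density `l(x, θ) = log f(x, θ)`. -/
def logDensity (f : E → EuclideanSpace ℝ (Fin m) → ℝ) (x : E)
    (θ : EuclideanSpace ℝ (Fin m)) : ℝ :=
  Real.log (f x θ)

/-- The score function `∂_i l(x, θ)`. -/
def score (f : E → EuclideanSpace ℝ (Fin m) → ℝ) (i : Fin m) (x : E)
    (θ : EuclideanSpace ℝ (Fin m)) : ℝ :=
  pd i (logDensity f x) θ

/-- The second derivative `∂_i ∂_j l(x, θ)` of the log-density. -/
def hess (f : E → EuclideanSpace ℝ (Fin m) → ℝ) (i j : Fin m) (x : E)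
    (θ : EuclideanSpace ℝ (Fin m)) : ℝ :=
  pd i (fun θ' => score f j x θ') θ

variable [MeasurableSpace E]

/-- The expectation `⟨r⟩_θ = ∫ r(x) f(x, θ) dμ(x)`. -/
def expect (μ : Measure E) (f : E → EuclideanSpace ℝ (Fin m) → ℝ)
    (θ : EuclideanSpace ℝ (Fin m)) (r : E → ℝ) : ℝ :=
  ∫ x, r x * f x θ ∂μ

/-- Membership in the fibre `R_θ` of the Hilbert bundle: the random variable `r` has mean `0` and
a finite second moment under the density `f(·, θ)`. -/
def MemFibre (μ : Measure E) (f : E → EuclideanSpace ℝ (Fin m) → ℝ)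
    (θ : EuclideanSpace ℝ (Fin m)) (r : E → ℝ) : Prop :=
  Integrable (fun x => r x * f x θ) μ ∧ Integrable (fun x => r x ^ 2 * f x θ) μ ∧
    expect μ f θ r = 0

/-- The Fisher information metric `g_ij(θ) = ⟨∂_i l ∂_j l⟩_θ`. -/
def fisher (μ : Measure E) (f : E → EuclideanSpace ℝ (Fin m) → ℝ)
    (θ : EuclideanSpace ℝ (Fin m)) : Matrix (Fin m) (Fin m) ℝ :=
  Matrix.of fun i j => expect μ f θ (fun x => score f i x θ * score f j x θ)

/-- The skewness tensor `T_ijk(θ) = ⟨∂_i l ∂_j l ∂_k l⟩_θ`. -/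
def skewness (μ : Measure E) (f : E → EuclideanSpace ℝ (Fin m) → ℝ) (i j k : Fin m)
    (θ : EuclideanSpace ℝ (Fin m)) : ℝ :=
  expect μ f θ (fun x => score f i x θ * score f j x θ * score f k x θ)

/-- The `α`-covariant derivative of a score function,
`∇_i ∂_j l = ∂_i ∂_j l + (1 + α)/2 g_ij + (1 - α)/2 ∂_i l ∂_j l`. -/
def nablaScore (μ : Measure E) (f : E → EuclideanSpace ℝ (Fin m) → ℝ) (α : ℝ) (i j : Fin m)
    (x : E) (θ : EuclideanSpace ℝ (Fin m)) : ℝ :=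
  hess f i j x θ + (1 + α) / 2 * fisher μ f θ i j +
    (1 - α) / 2 * (score f i x θ * score f j x θ)

/-- The `α`-connection with lower indices,
`Γ_ijk = ⟨∂_i ∂_j l ∂_k l⟩_θ + (1 - α)/2 T_ijk`. -/
def connLower (μ : Measure E) (f : E → EuclideanSpace ℝ (Fin m) → ℝ) (α : ℝ) (i j k : Fin m)
    (θ : EuclideanSpace ℝ (Fin m)) : ℝ :=
  expect μ f θ (fun x => hess f i j x θ * score f k x θ) + (1 - α) / 2 * skewness μ f i j k θ

/-- The `α`-connection with one upper index, `Γ_ij^k = Γ_ijl g^{lk}`. -/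
def conn (μ : Measure E) (f : E → EuclideanSpace ℝ (Fin m) → ℝ) (α : ℝ) (i j k : Fin m)
    (θ : EuclideanSpace ℝ (Fin m)) : ℝ :=
  ∑ l, connLower μ f α i j l θ * (fisher μ f θ)⁻¹ l k

/-- The `α`-Euler–Schouten curvature tensor variable
`h_ij(x, θ) = ∇_i ∂_j l(x, θ) - Γ_ij^k(θ) ∂_k l(x, θ)`. -/
def eulerSchouten (μ : Measure E) (f : E → EuclideanSpace ℝ (Fin m) → ℝ) (α : ℝ) (i j : Fin m)
    (x : E) (θ : EuclideanSpace ℝ (Fin m)) : ℝ :=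
  nablaScore μ f α i j x θ - ∑ k, conn μ f α i j k θ * score f k x θ

theorem eulerSchouten_one (μ : Measure E) (f : E → EuclideanSpace ℝ (Fin m) → ℝ) (i j : Fin m)
    (x : E) (θ : EuclideanSpace ℝ (Fin m)) :
    eulerSchouten μ f 1 i j x θ =
      hess f i j x θ + fisher μ f θ i j - ∑ k, conn μ f 1 i j k θ * score f k x θ := by
  simp [eulerSchouten, nablaScore]

/-- `{f(x, θ) | θ ∈ Θ}` is an `m`-dimensional statistical manifold of densities with respect to
`μ`, with global coordinate system `θ`. The values of `f x` outside `Θ` play no role. -/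
structure IsStatManifold (μ : Measure E) (Θ : Set (EuclideanSpace ℝ (Fin m)))
    (f : E → EuclideanSpace ℝ (Fin m) → ℝ) : Prop where
  isOpen : IsOpen Θ
  homeomorphic : Nonempty (Θ ≃ₜ EuclideanSpace ℝ (Fin m))
  measurable : ∀ θ ∈ Θ, Measurable fun x => f x θ
  pos : ∀ᵐ x ∂μ, ∀ θ ∈ Θ, 0 < f x θ
  integral_eq_one : ∀ θ ∈ Θ, ∫ x, f x θ ∂μ = 1
  smooth : ∀ᵐ x ∂μ, ContDiffOn ℝ ∞ (f x) Θ
  /-- The coordinates `θ` specify a density: distinct parameters give distinct densities. -/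
  identifiable : ∀ θ₁ ∈ Θ, ∀ θ₂ ∈ Θ, (∀ᵐ x ∂μ, f x θ₁ = f x θ₂) → θ₁ = θ₂
  /-- The score functions are sections of the Hilbert bundle. -/
  score_mem : ∀ θ ∈ Θ, ∀ i, MemFibre μ f θ fun x => score f i x θ
  /-- The `1`-covariant derivatives `∂_i ∂_j l + g_ij` of the scores are sections of the
  Hilbert bundle. -/
  nablaScore_mem : ∀ θ ∈ Θ, ∀ i j, MemFibre μ f θ fun x => nablaScore μ f 1 i j x θ
  /-- The tangent space spanned by the scores is `m`-dimensional. -/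
  fisher_posDef : ∀ θ ∈ Θ, (fisher μ f θ).PosDef

/-- The exponential density `exp {l₀(x) + ξ^a t_a(x) - ψ(ξ)}` with natural parameter `ξ`,
canonical statistic `t` and carrier `exp l₀`. -/
def expDensity (l₀ : E → ℝ) (t : E → EuclideanSpace ℝ (Fin m))
    (ψ : EuclideanSpace ℝ (Fin m) → ℝ) (x : E) (ξ : EuclideanSpace ℝ (Fin m)) : ℝ :=
  Real.exp (l₀ x + ∑ a, ξ a * t x a - ψ ξ)

/-- `{f(x, θ) | θ ∈ Θ}` is an `m`-dimensional full regular minimally represented exponential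
family: after a smooth change of coordinates `ξ = φ(θ)` from `Θ` onto an open set `Ξ` of `ℝ^m`
(the target of `φ`), the densities are `exp {l₀(x) + ξ^a t_a(x) - ψ(ξ)}`. The potential `ψ` is
smooth on `Ξ` and convex; as `Ξ` need not be a convex set, convexity is required on its
convex hull. -/
def IsFRMExpFamily (μ : Measure E) (Θ : Set (EuclideanSpace ℝ (Fin m)))
    (f : E → EuclideanSpace ℝ (Fin m) → ℝ) : Prop :=
  ∃ (φ : OpenPartialHomeomorph (EuclideanSpace ℝ (Fin m)) (EuclideanSpace ℝ (Fin m)))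
    (l₀ : E → ℝ) (t : E → EuclideanSpace ℝ (Fin m)) (ψ : EuclideanSpace ℝ (Fin m) → ℝ),
    φ.source = Θ ∧ ContDiffOn ℝ ∞ φ φ.source ∧ ContDiffOn ℝ ∞ φ.symm φ.target ∧
    Measurable l₀ ∧ Measurable t ∧
    ContDiffOn ℝ ∞ ψ φ.target ∧ ConvexOn ℝ (convexHull ℝ φ.target) ψ ∧
    -- the densities have exponential form in the natural parameter
    (∀ᵐ x ∂μ, ∀ θ ∈ Θ, f x θ = expDensity l₀ t ψ x (φ θ)) ∧
    -- minimality: `1, t_1, …, t_m` are linearly independent modulo `μ`-null sets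
    (∀ (a : Fin m → ℝ) (c : ℝ), (∀ᵐ x ∂μ, ∑ i, a i * t x i = c) → a = 0) ∧
    -- the gradient of `ψ` is the expectation parameter
    (∀ θ ∈ Θ, ∀ a, Integrable (fun x => t x a * f x θ) μ ∧
      expect μ f θ (fun x => t x a) = pd a ψ (φ θ))

end StatManifold

end

/-!
If `f(x, θ) = exp {l₀(x) + ξ(θ)·t(x) - ψ(ξ(θ))}`, then `∂_i ∂_j l` is a combination of the scores
`∂_k l` and a constant, with coefficients that do not depend on `x`, because the Jacobian of `ξ` is
invertible. Taking means identifies the constant as `-g_ij`, and pairing with the scores identifies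
the coefficients as `Γ_ij^k` (`IsStatManifold.conn_one_eq_of_hess_ae_eq`), so `h_ij = 0`.

For the converse, `h_ij = 0` says `∂_i ∂_j l = Γ_ij^k ∂_k l - g_ij`. The last term is the same for
all `x`, so each difference `l(x, ·) - l(y, ·)` is an affine function for the connection `Γ`
(`IsConnAffineOn`). As the Fisher matrix is nonsingular, `m` such differences form a map `φ` with
invertible derivative at a given point. Where `Dφ` is invertible, differentiating `Du = c ∘ Dφ`
shows that `c` is constant for every affine `u` (`IsConnAffineOn.exists_fderiv_eq_comp`); comparison
with local coordinates of the same kind shows that `Dφ` stays invertible on the connected set `Θ`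
(`IsConnAffineOn.isUnit_fderiv`). This needs neither regularity of `Γ` nor simple connectedness of
`Θ`. Hence `l(x, θ) = l₀(x) + t(x)·φ(θ) - q(θ)` with `t(x) = c`
(`IsStatManifold.exists_exponential_form`). Since densities integrate to `1`, `q(θ)` is the cumulant
function `ψ(ξ) = log ∫ exp (l₀ + ξ·t) dμ` at `ξ = φ(θ)`. So `φ` is injective by identifiability,
and `ψ` is convex where it is finite (`convexOn_log_integral_exp`). The vanishing means of the
scores give the expectation parameter, without differentiation under the integral sign
(`IsStatManifold.isFRMExpFamily_of_exponential_form`).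
-/

namespace StatManifold

/-! ### Functions that are affine for a connection -/

section Affine

variable {V W : Type*} [NormedAddCommGroup V] [NormedSpace ℝ V]
  [NormedAddCommGroup W] [NormedSpace ℝ W]

/-- The smooth function `u` on `Θ` is affine for the connection with Christoffel symbols `Γ`,
that is `D²u(θ)(v, w) = Du(θ)(Γ_θ(v, w))`. The symbols are arbitrary: no regularity in `θ` and no
linearity in `v` is asked for. -/
structure IsConnAffineOn (Θ : Set V) (Γ : V → V → V →L[ℝ] V) (u : V → W) : Prop where
  contDiffOn : ContDiffOn ℝ ∞ u Θ
  fderiv_fderiv : ∀ θ ∈ Θ, ∀ v,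
    fderiv ℝ (fderiv ℝ u) θ v = (fderiv ℝ u θ).comp (Γ θ v)

theorem differentiableAt_of_contDiffOn {Θ : Set V} (hΘ : IsOpen Θ) {u : V → W}
    (hu : ContDiffOn ℝ ∞ u Θ) {θ : V} (hθ : θ ∈ Θ) : DifferentiableAt ℝ u θ :=
  (hu.contDiffAt (hΘ.mem_nhds hθ)).differentiableAt (by simp)

theorem differentiableAt_fderiv_of_contDiffOn {Θ : Set V} (hΘ : IsOpen Θ) {u : V → W}
    (hu : ContDiffOn ℝ ∞ u Θ) {θ : V} (hθ : θ ∈ Θ) : DifferentiableAt ℝ (fderiv ℝ u) θ :=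
  differentiableAt_of_contDiffOn hΘ (hu.fderiv_of_isOpen hΘ (m := ∞) (by simp)) hθ

theorem IsConnAffineOn.mono {Θ B : Set V} {Γ : V → V → V →L[ℝ] V} {u : V → W}
    (h : IsConnAffineOn Θ Γ u) (hB : B ⊆ Θ) : IsConnAffineOn B Γ u :=
  ⟨h.contDiffOn.mono hB, fun θ hθ => h.fderiv_fderiv θ (hB hθ)⟩

theorem IsConnAffineOn.sum_smul {Θ : Set V} (hΘ : IsOpen Θ) {Γ : V → V → V →L[ℝ] V}
    {ι : Type*} [Fintype ι] {u : ι → V → ℝ} (h : ∀ a, IsConnAffineOn Θ Γ (u a)) (e : ι → W) :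
    IsConnAffineOn Θ Γ (fun θ => ∑ a, u a θ • e a) ∧
      ∀ θ ∈ Θ, fderiv ℝ (fun θ => ∑ a, u a θ • e a) θ =
        ∑ a, (fderiv ℝ (u a) θ).smulRight (e a) := by
  have hd : ∀ θ ∈ Θ, fderiv ℝ (fun θ => ∑ a, u a θ • e a) θ =
        ∑ a, (fderiv ℝ (u a) θ).smulRight (e a) := by
    intro θ hθ
    refine HasFDerivAt.fderiv (HasFDerivAt.fun_sum fun a _ => ?_)
    exact ((differentiableAt_of_contDiffOn hΘ (h a).contDiffOn hθ).hasFDerivAt.smul_const (e a))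
  refine ⟨⟨ContDiffOn.sum fun a _ => (h a).contDiffOn.smul contDiffOn_const, ?_⟩, hd⟩
  intro θ hθ v
  have hev : fderiv ℝ (fun θ => ∑ a, u a θ • e a) =ᶠ[nhds θ] fun θ =>
      ∑ a, (ContinuousLinearMap.smulRightL ℝ V W).flip (e a) (fderiv ℝ (u a) θ) := by
    filter_upwards [hΘ.mem_nhds hθ] with θ' hθ'
    simp [hd θ' hθ']
  have h2 : HasFDerivAt (fun θ =>
      ∑ a, (ContinuousLinearMap.smulRightL ℝ V W).flip (e a) (fderiv ℝ (u a) θ))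
      (∑ a, ((ContinuousLinearMap.smulRightL ℝ V W).flip (e a)).comp
        (fderiv ℝ (fderiv ℝ (u a)) θ)) θ :=
    HasFDerivAt.fun_sum fun a _ => (ContinuousLinearMap.hasFDerivAt _).comp θ
      (differentiableAt_fderiv_of_contDiffOn hΘ (h a).contDiffOn hθ).hasFDerivAt
  rw [hev.fderiv_eq, h2.fderiv, hd θ hθ]
  ext w
  simp [(h _).fderiv_fderiv θ hθ v]

theorem exists_apply_eq_of_isUnit {L : V →L[ℝ] V} (h : IsUnit L) (w : V) : ∃ v, L v = w := by
  obtain ⟨e, rfl⟩ := h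
  exact ⟨(↑e⁻¹ : V →L[ℝ] V) w, by rw [← mul_apply_eq_comp, Units.mul_inv]; rfl⟩

variable [FiniteDimensional ℝ V]

/-- Where `φ` is an affine immersion into a space of the same dimension, the derivative of every
other affine function is a constant multiple of `Dφ`. With `c = Du ∘ (Dφ)⁻¹`, differentiating
`Du = c ∘ Dφ` gives `Du ∘ Γ v = (Dc v) ∘ Dφ + c ∘ Dφ ∘ Γ v`, so that `Dc = 0`. -/
theorem IsConnAffineOn.exists_fderiv_eq_comp {B : Set V} (hB : IsOpen B) (hB' : IsPreconnected B)
    {Γ : V → V → V →L[ℝ] V} {φ : V → V} (hφ : IsConnAffineOn B Γ φ)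
    (hunit : ∀ θ ∈ B, IsUnit (fderiv ℝ φ θ)) {u : V → W} (hu : IsConnAffineOn B Γ u) :
    ∃ c : V →L[ℝ] W, ∀ θ ∈ B, fderiv ℝ u θ = c.comp (fderiv ℝ φ θ) := by
  have : CompleteSpace V := FiniteDimensional.complete ℝ V
  set c : V → V →L[ℝ] W := fun θ => (fderiv ℝ u θ).comp (Ring.inverse (fderiv ℝ φ θ)) with hc
  have hcφ : ∀ θ ∈ B, fderiv ℝ u θ = (c θ).comp (fderiv ℝ φ θ) := by
    intro θ hθ
    have h1 : (Ring.inverse (fderiv ℝ φ θ)).comp (fderiv ℝ φ θ) = 1 :=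
      Ring.inverse_mul_cancel _ (hunit θ hθ)
    rw [hc, ContinuousLinearMap.comp_assoc, h1]
    rfl
  have hdc : ∀ θ ∈ B, DifferentiableAt ℝ c θ := fun θ hθ =>
    (differentiableAt_fderiv_of_contDiffOn hB hu.contDiffOn hθ).clm_comp
      ((differentiableAt_fderiv_of_contDiffOn hB hφ.contDiffOn hθ).inverse (hunit θ hθ))
  have hzero : ∀ θ ∈ B, fderiv ℝ c θ = 0 := by
    intro θ hθ
    have hev : fderiv ℝ u =ᶠ[nhds θ] fun θ => (c θ).comp (fderiv ℝ φ θ) := by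
      filter_upwards [hB.mem_nhds hθ] with θ' hθ' using hcφ θ' hθ'
    have h1 := ((hdc θ hθ).hasFDerivAt.clm_comp
      (differentiableAt_fderiv_of_contDiffOn hB hφ.contDiffOn hθ).hasFDerivAt).fderiv
    rw [← hev.fderiv_eq] at h1
    ext v w
    obtain ⟨z, rfl⟩ := exists_apply_eq_of_isUnit (hunit θ hθ) w
    have h2 := congrArg (fun L => L v z) h1
    simp only [hu.fderiv_fderiv θ hθ v, hφ.fderiv_fderiv θ hθ v, hcφ θ hθ,
      add_apply, ContinuousLinearMap.comp_apply,
      ContinuousLinearMap.compL_apply, ContinuousLinearMap.flip_apply] at h2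
    simpa using h2
  obtain rfl | ⟨θ₁, hθ₁⟩ := B.eq_empty_or_nonempty
  · exact ⟨0, by simp⟩
  refine ⟨c θ₁, fun θ hθ => ?_⟩
  rw [hcφ θ hθ, hB.is_const_of_fderiv_eq_zero hB'
    (fun θ hθ => (hdc θ hθ).differentiableWithinAt) hzero hθ hθ₁]

/-- An affine map that is immersive at one point of a connected open set is immersive everywhere,
provided that every point has some affine map that is immersive there. -/
theorem IsConnAffineOn.isUnit_fderiv {Θ : Set V} (hΘ : IsOpen Θ) (hΘ' : IsPreconnected Θ)
    {Γ : V → V → V →L[ℝ] V} {φ : V → V} (hφ : IsConnAffineOn Θ Γ φ) {θ₀ : V} (hθ₀ : θ₀ ∈ Θ)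
    (h0 : IsUnit (fderiv ℝ φ θ₀))
    (hloc : ∀ θ ∈ Θ, ∃ χ : V → V, IsConnAffineOn Θ Γ χ ∧ IsUnit (fderiv ℝ χ θ)) :
    ∀ θ ∈ Θ, IsUnit (fderiv ℝ φ θ) := by
  have : CompleteSpace V := FiniteDimensional.complete ℝ V
  have hopen : ∀ χ : V → V, IsConnAffineOn Θ Γ χ →
      IsOpen (Θ ∩ {θ | IsUnit (fderiv ℝ χ θ)}) := fun χ hχ =>
    ContinuousOn.isOpen_inter_preimage (t := {L : V →L[ℝ] V | IsUnit L})
      (hχ.contDiffOn.continuousOn_fderiv_of_isOpen hΘ (by simp)) hΘ Units.isOpen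
  have hsub : Θ ⊆ Θ ∩ {θ | IsUnit (fderiv ℝ φ θ)} := by
    refine hΘ'.subset_of_closure_inter_subset (hopen φ hφ) ⟨θ₀, hθ₀, hθ₀, h0⟩ ?_
    rintro θ₁ ⟨hcl, hθ₁⟩
    refine ⟨hθ₁, ?_⟩
    obtain ⟨χ, hχ, hχ1⟩ := hloc θ₁ hθ₁
    obtain ⟨r, hr, hball⟩ := Metric.isOpen_iff.1 (hopen χ hχ) θ₁ ⟨hθ₁, hχ1⟩
    have hballΘ : Metric.ball θ₁ r ⊆ Θ := fun θ hθ => (hball hθ).1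
    obtain ⟨c, hc⟩ := IsConnAffineOn.exists_fderiv_eq_comp Metric.isOpen_ball
      (convex_ball θ₁ r).isPreconnected (hχ.mono hballΘ) (fun θ hθ => (hball hθ).2)
      (hφ.mono hballΘ)
    obtain ⟨θ₂, hθ₂, hd⟩ := Metric.mem_closure_iff.1 hcl r hr
    have hθ₂b : θ₂ ∈ Metric.ball θ₁ r := by rwa [Metric.mem_ball, dist_comm]
    -- `c` is invertible because both derivatives are invertible at `θ₂`
    have hcu : IsUnit c := by
      have h1 : IsUnit (c * fderiv ℝ χ θ₂) := by
        have h2 : IsUnit (fderiv ℝ φ θ₂) := hθ₂.2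
        rwa [hc θ₂ hθ₂b] at h2
      obtain ⟨e, he⟩ : IsUnit (fderiv ℝ χ θ₂) := (hball hθ₂b).2
      rw [← he] at h1
      exact (Units.isUnit_mul_units c e).1 h1
    have h3 : fderiv ℝ φ θ₁ = c * fderiv ℝ χ θ₁ := hc θ₁ (Metric.mem_ball_self hr)
    change IsUnit (fderiv ℝ φ θ₁)
    rw [h3]
    exact hcu.mul hχ1
  exact fun θ hθ => (hsub hθ).2

/-- An injective smooth map with invertible derivatives on an open set is a diffeomorphism onto an
open set. -/
theorem exists_openPartialHomeomorph_of_isUnit_fderiv {Θ : Set V} (hΘ : IsOpen Θ) {φ : V → V}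
    (hφ : ContDiffOn ℝ ∞ φ Θ) (hunit : ∀ θ ∈ Θ, IsUnit (fderiv ℝ φ θ)) (hinj : Set.InjOn φ Θ) :
    ∃ e : OpenPartialHomeomorph V V, e.source = Θ ∧ (e : V → V) = φ ∧
      ContDiffOn ℝ ∞ e.symm e.target := by
  have : CompleteSpace V := FiniteDimensional.complete ℝ V
  have hequiv : ∀ θ ∈ Θ, ∃ L : V ≃L[ℝ] V, (L : V →L[ℝ] V) = fderiv ℝ φ θ := fun θ hθ => by
    obtain ⟨e, he⟩ := hunit θ hθ
    exact ⟨ContinuousLinearEquiv.unitsEquiv ℝ V e, by rw [← he]; rfl⟩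
  have hopen : IsOpenMap (Θ.domRestrict φ) := by
    rw [IsOpenMap.eq_1]
    intro U hU
    have h1 : Θ.domRestrict φ '' U = φ '' (Subtype.val '' U) := by
      rw [Set.image_image]; rfl
    rw [h1]
    have hU' : IsOpen (Subtype.val '' U : Set V) := hΘ.isOpenMap_subtype_val U hU
    rw [isOpen_iff_mem_nhds]
    rintro _ ⟨θ, hθ, rfl⟩
    have hθΘ : θ ∈ Θ := by
      obtain ⟨θ', -, rfl⟩ := hθ
      exact θ'.2
    obtain ⟨L, hL⟩ := hequiv θ hθΘ
    have hs : HasStrictFDerivAt φ (L : V →L[ℝ] V) θ := by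
      rw [hL]
      exact (hφ.contDiffAt (hΘ.mem_nhds hθΘ)).hasStrictFDerivAt (by simp)
    rw [← hs.map_nhds_eq_of_equiv]
    exact Filter.image_mem_map (hU'.mem_nhds hθ)
  refine ⟨OpenPartialHomeomorph.ofContinuousOpenRestrict hinj.toPartialEquiv hφ.continuousOn
    hopen hΘ, rfl, rfl, ?_⟩
  set e := OpenPartialHomeomorph.ofContinuousOpenRestrict hinj.toPartialEquiv hφ.continuousOn
    hopen hΘ
  intro ξ hξ
  have hθ : e.symm ξ ∈ Θ := e.map_target hξ
  obtain ⟨L, hL⟩ := hequiv _ hθ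
  refine ContDiffAt.contDiffWithinAt (e.contDiffAt_symm hξ (f₀' := L) ?_
    (hφ.contDiffAt (hΘ.mem_nhds hθ)))
  rw [hL]
  exact (differentiableAt_of_contDiffOn hΘ hφ hθ).hasFDerivAt

end Affine

/-! ### The exponential form of a log-density -/

/-- The derivatives of a function of exponential form `θ ↦ c + T(φ(θ)) - q(θ)`. -/
theorem fderiv_of_eq_exponential_form {V : Type*} [NormedAddCommGroup V] [NormedSpace ℝ V]
    {Θ : Set V} (hΘ : IsOpen Θ) {φ : V → V} {q u : V → ℝ} {c : ℝ} {T : V →L[ℝ] ℝ}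
    (hφ : ContDiffOn ℝ ∞ φ Θ) (hq : ContDiffOn ℝ ∞ q Θ)
    (hu : ∀ θ ∈ Θ, u θ = c + T (φ θ) - q θ) :
    (∀ θ ∈ Θ, fderiv ℝ u θ = T.comp (fderiv ℝ φ θ) - fderiv ℝ q θ) ∧
      ∀ θ ∈ Θ, ∀ v, fderiv ℝ (fderiv ℝ u) θ v =
        T.comp (fderiv ℝ (fderiv ℝ φ) θ v) - fderiv ℝ (fderiv ℝ q) θ v := by
  have hd : ∀ θ ∈ Θ, fderiv ℝ u θ = T.comp (fderiv ℝ φ θ) - fderiv ℝ q θ := by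
    intro θ hθ
    have hev : u =ᶠ[nhds θ] fun θ => c + T (φ θ) - q θ := by
      filter_upwards [hΘ.mem_nhds hθ] with θ' hθ' using hu θ' hθ'
    rw [hev.fderiv_eq]
    exact (((T.hasFDerivAt.comp θ (differentiableAt_of_contDiffOn hΘ hφ hθ).hasFDerivAt).const_add
      c).sub (differentiableAt_of_contDiffOn hΘ hq hθ).hasFDerivAt).fderiv
  refine ⟨hd, fun θ hθ v => ?_⟩
  have hev : fderiv ℝ u =ᶠ[nhds θ] fun θ => T.comp (fderiv ℝ φ θ) - fderiv ℝ q θ := by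
    filter_upwards [hΘ.mem_nhds hθ] with θ' hθ' using hd θ' hθ'
  rw [hev.fderiv_eq, (((hasFDerivAt_const T θ).clm_comp
    (differentiableAt_fderiv_of_contDiffOn hΘ hφ hθ).hasFDerivAt).fun_sub
    (differentiableAt_fderiv_of_contDiffOn hΘ hq hθ).hasFDerivAt).fderiv]
  ext w
  simp

/-- The linear form `ξ ↦ ξ^a s_a` on the space of natural parameters. -/
noncomputable def pairing {m : ℕ} (s : EuclideanSpace ℝ (Fin m)) : EuclideanSpace ℝ (Fin m) →L[ℝ] ℝ :=
  ∑ a, s a • EuclideanSpace.proj a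

theorem pairing_apply {m : ℕ} (s ξ : EuclideanSpace ℝ (Fin m)) :
    pairing s ξ = ∑ a, ξ a * s a := by
  simp [pairing, mul_comm]

/-! ### Convexity of the cumulant function -/

/-- The cumulant function is convex on the set of natural parameters where it is finite. After
normalization of the exponentials by their integrals, this is the convexity of `exp` under the
integral sign. -/
theorem convexOn_log_integral_exp {E : Type*} [MeasurableSpace E] {m : ℕ} (μ : Measure E)
    [NeZero μ] {l₀ : E → ℝ} {t : E → EuclideanSpace ℝ (Fin m)} (hl : Measurable l₀)
    (ht : Measurable t) :
    ConvexOn ℝ {ξ : EuclideanSpace ℝ (Fin m) |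
        Integrable (fun x => Real.exp (l₀ x + pairing (t x) ξ)) μ}
      fun ξ => Real.log (∫ x, Real.exp (l₀ x + pairing (t x) ξ) ∂μ) := by
  have hmeas : ∀ ξ, Measurable fun x => Real.exp (l₀ x + pairing (t x) ξ) := fun ξ => by
    simp only [pairing_apply]
    fun_prop
  set ψ : EuclideanSpace ℝ (Fin m) → ℝ :=
    fun ξ => Real.log (∫ x, Real.exp (l₀ x + pairing (t x) ξ) ∂μ)
  have hexp : ∀ ξ, Integrable (fun x => Real.exp (l₀ x + pairing (t x) ξ)) μ →
      Real.exp (ψ ξ) = ∫ x, Real.exp (l₀ x + pairing (t x) ξ) ∂μ := fun ξ hξ =>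
    Real.exp_log (integral_exp_pos hξ)
  have key : ∀ ξ η : EuclideanSpace ℝ (Fin m),
      Integrable (fun x => Real.exp (l₀ x + pairing (t x) ξ)) μ →
      Integrable (fun x => Real.exp (l₀ x + pairing (t x) η)) μ → ∀ a b : ℝ, 0 ≤ a → 0 ≤ b →
      a + b = 1 → Integrable (fun x => Real.exp (l₀ x + pairing (t x) (a • ξ + b • η))) μ ∧
        ∫ x, Real.exp (l₀ x + pairing (t x) (a • ξ + b • η)) ∂μ ≤
          Real.exp (a * ψ ξ + b * ψ η) := by
    intro ξ η hξ hη a b ha hb hab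
    set K := Real.exp (a * ψ ξ + b * ψ η) with hK
    have hpt : ∀ x, Real.exp (l₀ x + pairing (t x) (a • ξ + b • η)) ≤
        K * (a * (Real.exp (-ψ ξ) * Real.exp (l₀ x + pairing (t x) ξ)) +
          b * (Real.exp (-ψ η) * Real.exp (l₀ x + pairing (t x) η))) := by
      intro x
      have h1 := convexOn_exp.2 (Set.mem_univ (-ψ ξ + (l₀ x + pairing (t x) ξ)))
        (Set.mem_univ (-ψ η + (l₀ x + pairing (t x) η))) ha hb hab
      simp only [smul_eq_mul] at h1
      rw [← Real.exp_add, ← Real.exp_add]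
      refine le_trans (le_of_eq ?_) (mul_le_mul_of_nonneg_left h1 (Real.exp_pos _).le)
      rw [hK, ← Real.exp_add]
      congr 1
      simp only [map_add, map_smul, smul_eq_mul]
      linear_combination (-(l₀ x)) * hab
    have hint : Integrable (fun x => K *
        (a * (Real.exp (-ψ ξ) * Real.exp (l₀ x + pairing (t x) ξ)) +
          b * (Real.exp (-ψ η) * Real.exp (l₀ x + pairing (t x) η)))) μ :=
      (((hξ.const_mul _).const_mul _).add ((hη.const_mul _).const_mul _)).const_mul _
    have hI : Integrable (fun x => Real.exp (l₀ x + pairing (t x) (a • ξ + b • η))) μ := by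
      refine hint.mono' (hmeas _).aestronglyMeasurable (.of_forall fun x => ?_)
      rw [Real.norm_of_nonneg (Real.exp_pos _).le]
      exact hpt x
    refine ⟨hI, (integral_mono hI hint hpt).trans (le_of_eq ?_)⟩
    rw [integral_const_mul, integral_add ((hξ.const_mul _).const_mul _)
      ((hη.const_mul _).const_mul _)]
    simp only [integral_const_mul]
    rw [← hexp ξ hξ, ← hexp η hη, ← Real.exp_add, ← Real.exp_add]
    simp [hab]
  refine ⟨fun ξ hξ η hη a b ha hb hab => (key ξ η hξ hη a b ha hb hab).1,
    fun ξ hξ η hη a b ha hb hab => ?_⟩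
  obtain ⟨hI, hle⟩ := key ξ η hξ hη a b ha hb hab
  exact (Real.log_le_iff_le_exp (integral_exp_pos hI)).2 hle

/-! ### Scores of a statistical manifold -/

section Scores

variable {E : Type*} {m : ℕ} {f : E → EuclideanSpace ℝ (Fin m) → ℝ}

theorem fderiv_logDensity_apply (x : E) (θ v : EuclideanSpace ℝ (Fin m)) :
    fderiv ℝ (logDensity f x) θ v = ∑ i, v i * score f i x θ := by
  conv_lhs => rw [← (EuclideanSpace.basisFun (Fin m) ℝ).sum_repr v, map_sum]
  simp [score, pd]

theorem hess_eq_fderiv_fderiv {x : E} {θ : EuclideanSpace ℝ (Fin m)}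
    (h : DifferentiableAt ℝ (fderiv ℝ (logDensity f x)) θ) (i j : Fin m) :
    hess f i j x θ = fderiv ℝ (fderiv ℝ (logDensity f x)) θ (EuclideanSpace.single i 1)
      (EuclideanSpace.single j 1) := by
  simp only [hess, pd, score]
  rw [fderiv_clm_apply h (differentiableAt_const _)]
  simp

variable [MeasurableSpace E] {μ : Measure E} {Θ : Set (EuclideanSpace ℝ (Fin m))}

theorem IsStatManifold.ae_contDiffOn_logDensity (hM : IsStatManifold μ Θ f) :
    ∀ᵐ x ∂μ, ContDiffOn ℝ ∞ (logDensity f x) Θ := by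
  filter_upwards [hM.pos, hM.smooth] with x hp hs
  exact hs.log fun θ hθ => (hp θ hθ).ne'

theorem IsStatManifold.nonempty (hM : IsStatManifold μ Θ f) : Θ.Nonempty := by
  obtain ⟨e⟩ := hM.homeomorphic
  exact ⟨e.symm 0, (e.symm 0).2⟩

theorem IsStatManifold.isPreconnected (hM : IsStatManifold μ Θ f) : IsPreconnected Θ := by
  obtain ⟨e⟩ := hM.homeomorphic
  rw [isPreconnected_iff_preconnectedSpace]
  exact e.symm.surjective.denseRange.preconnectedSpace e.symm.continuous

variable {θ : EuclideanSpace ℝ (Fin m)}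

theorem IsStatManifold.integrable (hM : IsStatManifold μ Θ f) (hθ : θ ∈ Θ) :
    Integrable (fun x => f x θ) μ :=
  Integrable.of_integral_ne_zero (by simp [hM.integral_eq_one θ hθ])

theorem IsStatManifold.neZero (hM : IsStatManifold μ Θ f) : NeZero μ := by
  refine ⟨fun h => ?_⟩
  obtain ⟨θ, hθ⟩ := hM.nonempty
  simpa [h] using hM.integral_eq_one θ hθ

/-- Only the product of a score with the density is known to be measurable; the density is
measurable and almost everywhere nonzero. -/
theorem IsStatManifold.aemeasurable_score (hM : IsStatManifold μ Θ f) (hθ : θ ∈ Θ) (i : Fin m) :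
    AEMeasurable (fun x => score f i x θ) μ := by
  have h1 := ((hM.score_mem θ hθ i).1.aestronglyMeasurable.aemeasurable).div
    (hM.measurable θ hθ).aemeasurable
  refine h1.congr ?_
  filter_upwards [hM.pos] with x hx
  simp [(hx θ hθ).ne']

theorem IsStatManifold.integrable_score_mul_score (hM : IsStatManifold μ Θ f) (hθ : θ ∈ Θ)
    (i j : Fin m) : Integrable (fun x => score f i x θ * score f j x θ * f x θ) μ := by
  refine ((hM.score_mem θ hθ i).2.1.add (hM.score_mem θ hθ j).2.1).mono'
    (((hM.aemeasurable_score hθ i).mul (hM.aemeasurable_score hθ j)).mul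
      (hM.measurable θ hθ).aemeasurable).aestronglyMeasurable ?_
  filter_upwards [hM.pos] with x hx
  have h := hx θ hθ
  simp only [Pi.add_apply, norm_mul, Real.norm_eq_abs, abs_of_pos h, ← add_mul]
  refine mul_le_mul_of_nonneg_right ?_ h.le
  nlinarith [sq_abs (score f i x θ), sq_abs (score f j x θ),
    sq_nonneg (|score f i x θ| - |score f j x θ|)]

theorem IsStatManifold.integrable_fderiv_logDensity (hM : IsStatManifold μ Θ f) (hθ : θ ∈ Θ)
    (v : EuclideanSpace ℝ (Fin m)) :
    Integrable (fun x => fderiv ℝ (logDensity f x) θ v * f x θ) μ := by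
  simp only [fderiv_logDensity_apply, Finset.sum_mul, mul_assoc]
  exact integrable_finsetSum _ fun i _ => (hM.score_mem θ hθ i).1.const_mul _

theorem IsStatManifold.integral_fderiv_logDensity (hM : IsStatManifold μ Θ f) (hθ : θ ∈ Θ)
    (v : EuclideanSpace ℝ (Fin m)) :
    ∫ x, fderiv ℝ (logDensity f x) θ v * f x θ ∂μ = 0 := by
  simp only [fderiv_logDensity_apply, Finset.sum_mul, mul_assoc]
  rw [integral_finsetSum _ fun i _ => (hM.score_mem θ hθ i).1.const_mul _]
  simp only [integral_const_mul]
  exact Finset.sum_eq_zero fun i _ => by rw [show ∫ x, score f i x θ * f x θ ∂μ = 0 from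
    (hM.score_mem θ hθ i).2.2, mul_zero]

theorem IsStatManifold.integral_fderiv_logDensity_mul_score (hM : IsStatManifold μ Θ f)
    (hθ : θ ∈ Θ) (v : EuclideanSpace ℝ (Fin m)) (j : Fin m) :
    Integrable (fun x => fderiv ℝ (logDensity f x) θ v * score f j x θ * f x θ) μ ∧
    ∫ x, fderiv ℝ (logDensity f x) θ v * score f j x θ * f x θ ∂μ =
      ∑ i, v i * fisher μ f θ i j := by
  simp only [fderiv_logDensity_apply, Finset.sum_mul, mul_assoc (v _)]
  have h : ∀ i ∈ Finset.univ, Integrable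
      (fun x => v i * (score f i x θ * score f j x θ * f x θ)) μ :=
    fun i _ => (hM.integrable_score_mul_score hθ i j).const_mul _
  simp only [mul_assoc] at h ⊢
  refine ⟨integrable_finsetSum _ h, ?_⟩
  rw [integral_finsetSum _ h]
  simp only [integral_const_mul, fisher, expect, Matrix.of_apply, mul_assoc]

/-- The scores and the constant `1` are linearly independent modulo null functions: a constant
combination of scores has mean `0`, so it is `0`, and then the Fisher matrix kills its
coefficients. -/
theorem IsStatManifold.eq_zero_of_fderiv_logDensity_ae_eq_const (hM : IsStatManifold μ Θ f)
    (hθ : θ ∈ Θ) {v : EuclideanSpace ℝ (Fin m)} {c : ℝ}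
    (h : ∀ᵐ x ∂μ, fderiv ℝ (logDensity f x) θ v = c) : v = 0 := by
  have hc : c = 0 := by
    rw [← hM.integral_fderiv_logDensity hθ v]
    have h1 : ∫ x, fderiv ℝ (logDensity f x) θ v * f x θ ∂μ = ∫ x, c * f x θ ∂μ := by
      refine integral_congr_ae ?_
      filter_upwards [h] with x hx
      rw [hx]
    rw [h1, integral_const_mul, hM.integral_eq_one θ hθ, mul_one]
  have hz : ∀ j, ∑ i, v i * fisher μ f θ i j = 0 := by
    intro j
    rw [← (hM.integral_fderiv_logDensity_mul_score hθ v j).2]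
    refine integral_eq_zero_of_ae ?_
    filter_upwards [h] with x hx
    simp [hx, hc]
  have hdot : star (v : Fin m → ℝ) ⬝ᵥ (fisher μ f θ).mulVec v = 0 := by
    rw [Matrix.dotProduct_mulVec]
    have h2 : Matrix.vecMul (star (v : Fin m → ℝ)) (fisher μ f θ) = 0 := by
      ext j
      simpa [Matrix.vecMul, dotProduct] using hz j
    rw [h2, zero_dotProduct]
  by_contra hv
  have hv' : (v : Fin m → ℝ) ≠ 0 := fun h0 => hv (by ext i; exact congrFun h0 i)
  exact ((hM.fisher_posDef θ hθ).dotProduct_mulVec_pos hv').ne' hdot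

/-- If `∂_i ∂_j l` lies in the span of the scores and the constants, then its expansion is the one
given by the `1`-connection and the Fisher metric: the constant is found by taking means and the
coefficients by pairing with the scores. -/
theorem IsStatManifold.conn_one_eq_of_hess_ae_eq (hM : IsStatManifold μ Θ f) (hθ : θ ∈ Θ)
    {i j : Fin m} {z : EuclideanSpace ℝ (Fin m)} {d : ℝ}
    (h : ∀ᵐ x ∂μ, hess f i j x θ = fderiv ℝ (logDensity f x) θ z + d) :
    d = -fisher μ f θ i j ∧ ∀ k, conn μ f 1 i j k θ = z k := by
  have hd : d = -fisher μ f θ i j := by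
    have h0 := (hM.nablaScore_mem θ hθ i j).2.2
    have h1 : expect μ f θ (fun x => nablaScore μ f 1 i j x θ) =
        ∫ x, (fderiv ℝ (logDensity f x) θ z * f x θ + (d + fisher μ f θ i j) * f x θ) ∂μ := by
      refine integral_congr_ae ?_
      filter_upwards [h] with x hx
      rw [nablaScore, hx]
      ring
    rw [h1, integral_add (hM.integrable_fderiv_logDensity hθ z) ((hM.integrable hθ).const_mul _),
      hM.integral_fderiv_logDensity hθ, integral_const_mul, hM.integral_eq_one θ hθ] at h0
    linarith
  refine ⟨hd, fun k => ?_⟩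
  have hlow : ∀ l, connLower μ f 1 i j l θ = ∑ i, z i * fisher μ f θ i l := by
    intro l
    obtain ⟨hI, hE⟩ := hM.integral_fderiv_logDensity_mul_score hθ z l
    have h2 : expect μ f θ (fun x => hess f i j x θ * score f l x θ) =
        ∫ x, (fderiv ℝ (logDensity f x) θ z * score f l x θ * f x θ +
          d * (score f l x θ * f x θ)) ∂μ := by
      refine integral_congr_ae ?_
      filter_upwards [h] with x hx
      rw [hx]
      ring
    have h3 : ∫ x, score f l x θ * f x θ ∂μ = 0 := (hM.score_mem θ hθ l).2.2
    rw [connLower, h2, integral_add hI ((hM.score_mem θ hθ l).1.const_mul _), hE,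
      integral_const_mul, h3]
    simp
  have hdet : IsUnit (fisher μ f θ).det :=
    isUnit_iff_ne_zero.2 (hM.fisher_posDef θ hθ).det_pos.ne'
  have h4 : Matrix.vecMul (Matrix.vecMul (z : Fin m → ℝ) (fisher μ f θ)) (fisher μ f θ)⁻¹ = z := by
    rw [Matrix.vecMul_vecMul, Matrix.mul_nonsing_inv _ hdet, Matrix.vecMul_one]
  rw [conn]
  simp only [hlow]
  exact congrFun h4 k

end Scores

section Equivalence

variable {E : Type*} {m : ℕ} {f : E → EuclideanSpace ℝ (Fin m) → ℝ} [MeasurableSpace E]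
  {μ : Measure E} {Θ : Set (EuclideanSpace ℝ (Fin m))}

/-! ### Exponential families have vanishing curvature -/

theorem IsFRMExpFamily.eulerSchouten_eq_zero (hM : IsStatManifold μ Θ f)
    (h : IsFRMExpFamily μ Θ f) :
    ∀ᵐ x ∂μ, ∀ θ ∈ Θ, ∀ i j : Fin m, eulerSchouten μ f 1 i j x θ = 0 := by
  obtain ⟨φ, l₀, t, ψ, rfl, hφ, hφs, -, -, hψ, -, hf, -, -⟩ := h
  have hΘ := φ.open_source
  have hq : ContDiffOn ℝ ∞ (fun θ => ψ (φ θ)) φ.source :=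
    hψ.comp hφ fun θ hθ => φ.map_source hθ
  have hsurj : ∀ θ ∈ φ.source, ∀ w, ∃ v, fderiv ℝ φ θ v = w := by
    intro θ hθ w
    have hξ := φ.map_source hθ
    refine ⟨fderiv ℝ φ.symm (φ θ) w, ?_⟩
    have h1 : HasFDerivAt φ (fderiv ℝ φ θ) (φ.symm (φ θ)) := by
      rw [φ.left_inv hθ]
      exact (differentiableAt_of_contDiffOn hΘ hφ hθ).hasFDerivAt
    have h2 := h1.comp (φ θ)
      (differentiableAt_of_contDiffOn φ.open_target hφs hξ).hasFDerivAt
    have h3 : φ ∘ φ.symm =ᶠ[nhds (φ θ)] id := by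
      filter_upwards [φ.open_target.mem_nhds hξ] with ξ hξ using φ.right_inv hξ
    have h4 := (h2.congr_of_eventuallyEq h3.symm).unique (hasFDerivAt_id _)
    exact congrArg (fun L => L w) h4
  -- the derivatives of the log-densities
  have hder : ∀ᵐ x ∂μ, ContDiffOn ℝ ∞ (logDensity f x) φ.source ∧
      (∀ θ ∈ φ.source, fderiv ℝ (logDensity f x) θ =
        (pairing (t x)).comp (fderiv ℝ φ θ) - fderiv ℝ (fun θ => ψ (φ θ)) θ) ∧
      ∀ θ ∈ φ.source, ∀ v, fderiv ℝ (fderiv ℝ (logDensity f x)) θ v =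
        (pairing (t x)).comp (fderiv ℝ (fderiv ℝ φ) θ v) -
          fderiv ℝ (fderiv ℝ (fun θ => ψ (φ θ))) θ v := by
    filter_upwards [hM.ae_contDiffOn_logDensity, hf] with x hx hfx
    refine ⟨hx, fderiv_of_eq_exponential_form hΘ hφ hq (c := l₀ x) fun θ hθ => ?_⟩
    rw [logDensity, hfx θ hθ, expDensity, Real.log_exp, pairing_apply]
  -- with `z` a preimage of the second derivative of `φ` under the first, `∂_i ∂_j l` is the
  -- derivative of `l` along `z` up to a constant
  have hhess : ∀ θ ∈ φ.source, ∀ i j : Fin m, ∃ (z : EuclideanSpace ℝ (Fin m)) (d : ℝ), ∀ x,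
      (ContDiffOn ℝ ∞ (logDensity f x) φ.source ∧
      (∀ θ ∈ φ.source, fderiv ℝ (logDensity f x) θ =
        (pairing (t x)).comp (fderiv ℝ φ θ) - fderiv ℝ (fun θ => ψ (φ θ)) θ) ∧
      ∀ θ ∈ φ.source, ∀ v, fderiv ℝ (fderiv ℝ (logDensity f x)) θ v =
        (pairing (t x)).comp (fderiv ℝ (fderiv ℝ φ) θ v) -
          fderiv ℝ (fderiv ℝ (fun θ => ψ (φ θ))) θ v) →
      hess f i j x θ = fderiv ℝ (logDensity f x) θ z + d := by
    intro θ hθ i j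
    obtain ⟨z, hz⟩ := hsurj θ hθ (fderiv ℝ (fderiv ℝ φ) θ (EuclideanSpace.single i 1)
      (EuclideanSpace.single j 1))
    refine ⟨z, fderiv ℝ (fun θ => ψ (φ θ)) θ z -
      fderiv ℝ (fderiv ℝ (fun θ => ψ (φ θ))) θ (EuclideanSpace.single i 1)
        (EuclideanSpace.single j 1), ?_⟩
    rintro x ⟨hx, h1, h2⟩
    rw [hess_eq_fderiv_fderiv (differentiableAt_fderiv_of_contDiffOn hΘ hx hθ), h2 θ hθ,
      h1 θ hθ]
    simp [hz]
  filter_upwards [hder] with x hx θ hθ i j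
  obtain ⟨z, d, hzd⟩ := hhess θ hθ i j
  obtain ⟨hd, hconn⟩ := hM.conn_one_eq_of_hess_ae_eq hθ (hder.mono hzd)
  rw [eulerSchouten_one, hzd x hx, hd, fderiv_logDensity_apply]
  simp [hconn]

/-! ### Vanishing curvature gives an exponential form -/

/-- The Christoffel symbols of the `1`-connection as a family of endomorphisms,
`(v, w) ↦ v^i w^j Γ_ij^k ∂_k`. -/
noncomputable def christoffel (μ : Measure E) (f : E → EuclideanSpace ℝ (Fin m) → ℝ)
    (θ v : EuclideanSpace ℝ (Fin m)) :
    EuclideanSpace ℝ (Fin m) →L[ℝ] EuclideanSpace ℝ (Fin m) :=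
  ∑ i, ∑ j, v i • (EuclideanSpace.proj j : EuclideanSpace ℝ (Fin m) →L[ℝ] ℝ).smulRight
    (WithLp.toLp 2 fun k => conn μ f 1 i j k θ)

/-- The inhomogeneous term `-g_ij` of the equation `h_ij = 0` does not depend on `x`, so it cancels
in differences of log-densities. -/
theorem isConnAffineOn_logDensity_sub (hΘ : IsOpen Θ) {x y : E}
    (hx : ContDiffOn ℝ ∞ (logDensity f x) Θ) (hy : ContDiffOn ℝ ∞ (logDensity f y) Θ)
    (hx' : ∀ θ ∈ Θ, ∀ i j : Fin m, eulerSchouten μ f 1 i j x θ = 0)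
    (hy' : ∀ θ ∈ Θ, ∀ i j : Fin m, eulerSchouten μ f 1 i j y θ = 0) :
    IsConnAffineOn Θ (christoffel μ f) (fun θ => logDensity f x θ - logDensity f y θ) := by
  refine ⟨hx.sub hy, fun θ hθ v => ?_⟩
  have hd : ∀ θ ∈ Θ, fderiv ℝ (fun θ => logDensity f x θ - logDensity f y θ) θ =
      fderiv ℝ (logDensity f x) θ - fderiv ℝ (logDensity f y) θ := fun θ hθ =>
    fderiv_fun_sub (differentiableAt_of_contDiffOn hΘ hx hθ)
      (differentiableAt_of_contDiffOn hΘ hy hθ)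
  have hev : fderiv ℝ (fun θ => logDensity f x θ - logDensity f y θ) =ᶠ[nhds θ] fun θ =>
      fderiv ℝ (logDensity f x) θ - fderiv ℝ (logDensity f y) θ := by
    filter_upwards [hΘ.mem_nhds hθ] with θ' hθ' using hd θ' hθ'
  have hx2 := differentiableAt_fderiv_of_contDiffOn hΘ hx hθ
  have hy2 := differentiableAt_fderiv_of_contDiffOn hΘ hy hθ
  rw [hev.fderiv_eq, fderiv_fun_sub hx2 hy2, hd θ hθ]
  have hbil : ∀ (B : EuclideanSpace ℝ (Fin m) →L[ℝ] EuclideanSpace ℝ (Fin m) →L[ℝ] ℝ)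
      (v w : EuclideanSpace ℝ (Fin m)), B v w = ∑ i, ∑ j, v i * (w j *
        B (EuclideanSpace.single i 1) (EuclideanSpace.single j 1)) := by
    intro B v w
    conv_lhs =>
      rw [← (EuclideanSpace.basisFun (Fin m) ℝ).sum_repr v,
        ← (EuclideanSpace.basisFun (Fin m) ℝ).sum_repr w]
    simp only [EuclideanSpace.basisFun_repr, EuclideanSpace.basisFun_apply, map_sum, map_smul,
      sum_apply, smul_apply, smul_eq_mul, Finset.mul_sum]
    rw [Finset.sum_comm]
    exact Finset.sum_congr rfl fun i _ => Finset.sum_congr rfl fun j _ => by ring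
  ext w
  rw [ContinuousLinearMap.comp_apply, hbil]
  simp only [christoffel, sum_apply, map_sum, sub_apply, smul_apply,
    ContinuousLinearMap.smulRight_apply, map_smul, PiLp.proj_apply, smul_eq_mul,
    ← hess_eq_fderiv_fderiv hx2, ← hess_eq_fderiv_fderiv hy2]
  refine Finset.sum_congr rfl fun i _ => Finset.sum_congr rfl fun j _ => ?_
  have h1 := hx' θ hθ i j
  have h2 := hy' θ hθ i j
  rw [eulerSchouten_one] at h1 h2
  rw [fderiv_logDensity_apply, fderiv_logDensity_apply]
  linear_combination (v i * w j) * (h1 - h2)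

/-- At every parameter, `m` differences of log-densities form a local coordinate system: otherwise
some nonzero combination of the scores would be constant. -/
theorem IsStatManifold.exists_isUnit_fderiv_logDensity_sub (hM : IsStatManifold μ Θ f)
    {G : Set E} (hG : ∀ᵐ x ∂μ, x ∈ G) (hGs : ∀ x ∈ G, ContDiffOn ℝ ∞ (logDensity f x) Θ)
    {Γ : EuclideanSpace ℝ (Fin m) → EuclideanSpace ℝ (Fin m) →
      EuclideanSpace ℝ (Fin m) →L[ℝ] EuclideanSpace ℝ (Fin m)} {y : E} (hy : y ∈ G)
    (hΓ : ∀ x ∈ G, IsConnAffineOn Θ Γ (fun θ => logDensity f x θ - logDensity f y θ))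
    {θ : EuclideanSpace ℝ (Fin m)} (hθ : θ ∈ Θ) :
    ∃ χ : EuclideanSpace ℝ (Fin m) → EuclideanSpace ℝ (Fin m),
      IsConnAffineOn Θ Γ χ ∧ IsUnit (fderiv ℝ χ θ) := by
  set S : E → EuclideanSpace ℝ (Fin m) :=
    fun x => WithLp.toLp 2 fun i => score f i x θ - score f i y θ with hS
  have hinner : ∀ x ∈ G, ∀ v, inner ℝ (S x) v =
      fderiv ℝ (fun θ => logDensity f x θ - logDensity f y θ) θ v := by
    intro x hx v
    rw [fderiv_fun_sub (differentiableAt_of_contDiffOn hM.isOpen (hGs x hx) hθ)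
      (differentiableAt_of_contDiffOn hM.isOpen (hGs y hy) hθ), sub_apply,
      fderiv_logDensity_apply, fderiv_logDensity_apply, ← Finset.sum_sub_distrib]
    simp [hS, PiLp.inner_apply, mul_sub]
  have htop : Submodule.span ℝ (S '' G) = ⊤ := by
    rw [← Submodule.orthogonal_eq_bot_iff, eq_bot_iff]
    intro v hv
    rw [Submodule.mem_orthogonal] at hv
    rw [Submodule.mem_bot]
    refine hM.eq_zero_of_fderiv_logDensity_ae_eq_const hθ
      (c := fderiv ℝ (logDensity f y) θ v) ?_
    filter_upwards [hG] with x hx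
    have h1 := hv (S x) (Submodule.subset_span ⟨x, hx, rfl⟩)
    rw [hinner x hx, fderiv_fun_sub (differentiableAt_of_contDiffOn hM.isOpen (hGs x hx) hθ)
      (differentiableAt_of_contDiffOn hM.isOpen (hGs y hy) hθ), sub_apply] at h1
    exact sub_eq_zero.1 h1
  have hrank : Module.finrank ℝ (Submodule.span ℝ (S '' G)) = m := by
    rw [htop, finrank_top, finrank_euclideanSpace_fin]
  obtain ⟨g, hgS, hgspan, -⟩ := Submodule.exists_fun_fin_finrank_span_eq ℝ (S '' G)
  choose xs hxsG hxs using fun a => hgS (Fin.cast hrank.symm a)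
  have hspan : Submodule.span ℝ (Set.range fun a => S (xs a)) = ⊤ := by
    have h1 : (fun a => S (xs a)) = g ∘ Fin.cast hrank.symm := funext hxs
    have h2 : Function.Surjective (Fin.cast hrank.symm) := (finCongr hrank.symm).surjective
    rw [h1, h2.range_comp, hgspan, htop]
  obtain ⟨hχ, hχd⟩ := IsConnAffineOn.sum_smul hM.isOpen (fun a => hΓ (xs a) (hxsG a))
    (fun a => EuclideanSpace.single a (1 : ℝ))
  refine ⟨_, hχ, ?_⟩
  rw [ContinuousLinearMap.isUnit_iff_isUnit_toLinearMap, LinearMap.isUnit_iff_ker_eq_bot,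
    LinearMap.ker_eq_bot']
  intro v hv
  have hv2 : ∀ a, inner ℝ (S (xs a)) v = (0 : ℝ) := by
    intro a
    have h3 : fderiv ℝ (fun θ => ∑ a, (logDensity f (xs a) θ - logDensity f y θ) •
      EuclideanSpace.single a (1 : ℝ)) θ v = 0 := hv
    rw [hχd θ hθ] at h3
    have h4 := congrArg (fun w : EuclideanSpace ℝ (Fin m) => w a) h3
    rw [hinner _ (hxsG a)]
    simpa [Pi.single_apply] using h4
  have h5 : v ∈ (Submodule.span ℝ (Set.range fun a => S (xs a)))ᗮ := by
    rw [Submodule.mem_orthogonal]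
    intro u hu
    induction hu using Submodule.span_induction with
    | mem u hu => obtain ⟨a, rfl⟩ := hu; exact hv2 a
    | zero => simp
    | add u w _ _ hu hw => rw [inner_add_left, hu, hw, add_zero]
    | smul c u _ hu => rw [inner_smul_left, hu, mul_zero]
  rwa [hspan, Submodule.top_orthogonal_eq_bot, Submodule.mem_bot] at h5

/-- Vanishing curvature puts the log-densities in exponential form, with natural parameter the
affine immersion `φ` and with `t(x)` the constant `c` for which
`D(l(x, ·) - l(y, ·)) = c ∘ Dφ`, where `y` is a fixed base point. -/
theorem IsStatManifold.exists_exponential_form (hM : IsStatManifold μ Θ f)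
    (h : ∀ᵐ x ∂μ, ∀ θ ∈ Θ, ∀ i j : Fin m, eulerSchouten μ f 1 i j x θ = 0) :
    ∃ (φ : EuclideanSpace ℝ (Fin m) → EuclideanSpace ℝ (Fin m)) (l₀ : E → ℝ)
      (t : E → EuclideanSpace ℝ (Fin m)) (q : EuclideanSpace ℝ (Fin m) → ℝ),
      ContDiffOn ℝ ∞ φ Θ ∧ (∀ θ ∈ Θ, IsUnit (fderiv ℝ φ θ)) ∧ Measurable l₀ ∧ Measurable t ∧
      ContDiffOn ℝ ∞ q Θ ∧
      ∀ᵐ x ∂μ, ∀ θ ∈ Θ, logDensity f x θ = l₀ x + pairing (t x) (φ θ) - q θ := by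
  have := hM.neZero
  have hΘ := hM.isOpen
  obtain ⟨θ₀, hθ₀⟩ := hM.nonempty
  set G : Set E := {x | ContDiffOn ℝ ∞ (logDensity f x) Θ ∧
    ∀ θ ∈ Θ, ∀ i j : Fin m, eulerSchouten μ f 1 i j x θ = 0}
  have hG : ∀ᵐ x ∂μ, x ∈ G := by
    filter_upwards [hM.ae_contDiffOn_logDensity, h] with x h1 h2 using ⟨h1, h2⟩
  obtain ⟨y, hy⟩ := hG.exists
  have hΓ : ∀ x ∈ G, IsConnAffineOn Θ (christoffel μ f)
      (fun θ => logDensity f x θ - logDensity f y θ) := fun x hx =>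
    isConnAffineOn_logDensity_sub hΘ hx.1 hy.1 hx.2 hy.2
  have hloc := fun θ (hθ : θ ∈ Θ) =>
    hM.exists_isUnit_fderiv_logDensity_sub hG (fun x hx => hx.1) hy hΓ hθ
  obtain ⟨φ, hφ, hφ0⟩ := hloc θ₀ hθ₀
  have hunit := hφ.isUnit_fderiv hΘ hM.isPreconnected hθ₀ hφ0 hloc
  choose b hb using fun a : Fin m =>
    exists_apply_eq_of_isUnit hφ0 (EuclideanSpace.single a (1 : ℝ))
  -- the statistic is read off from the scores at `θ₀`, which makes it measurable
  have haem : ∀ a, AEMeasurable (fun x => fderiv ℝ (logDensity f x) θ₀ (b a) -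
      fderiv ℝ (logDensity f y) θ₀ (b a)) μ := fun a => by
    simp only [fderiv_logDensity_apply]
    refine AEMeasurable.sub_const (Finset.aemeasurable_fun_sum _ fun i _ => ?_) _
    exact (hM.aemeasurable_score hθ₀ i).const_mul _
  set t : E → EuclideanSpace ℝ (Fin m) := fun x => WithLp.toLp 2 fun a => (haem a).mk _ x with ht
  have htm : Measurable t :=
    (WithLp.measurable_toLp 2 _).comp (measurable_pi_lambda _ fun a => (haem a).measurable_mk)
  refine ⟨φ, fun x => logDensity f x θ₀ - pairing (t x) (φ θ₀), t,
    fun θ => logDensity f y θ₀ - logDensity f y θ, hφ.contDiffOn, hunit, ?_, htm,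
    contDiffOn_const.sub hy.1, ?_⟩
  · refine Measurable.sub (hM.measurable θ₀ hθ₀).log ?_
    simp only [pairing_apply]
    fun_prop
  have hmk : ∀ᵐ x ∂μ, ∀ a, t x a = fderiv ℝ (logDensity f x) θ₀ (b a) -
      fderiv ℝ (logDensity f y) θ₀ (b a) := ae_all_iff.2 fun a => by
    filter_upwards [(haem a).ae_eq_mk] with x hx using hx.symm
  filter_upwards [hG, hmk] with x hx htx
  obtain ⟨c, hc⟩ := IsConnAffineOn.exists_fderiv_eq_comp hΘ hM.isPreconnected hφ hunit (hΓ x hx)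
  have hct : c = pairing (t x) := by
    refine ContinuousLinearMap.coe_injective
      ((EuclideanSpace.basisFun (Fin m) ℝ).toBasis.ext fun a => ?_)
    have h1 : c (EuclideanSpace.single a 1) = t x a := by
      rw [← hb a, ← ContinuousLinearMap.comp_apply, ← hc θ₀ hθ₀, htx a,
        fderiv_fun_sub (differentiableAt_of_contDiffOn hΘ hx.1 hθ₀)
          (differentiableAt_of_contDiffOn hΘ hy.1 hθ₀), sub_apply]
    simpa [pairing_apply] using h1
  intro θ hθ
  have hdu : ∀ θ ∈ Θ, HasFDerivAt (fun θ => logDensity f x θ - logDensity f y θ - c (φ θ))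
      (0 : EuclideanSpace ℝ (Fin m) →L[ℝ] ℝ) θ := fun θ hθ => by
    have h2 := (differentiableAt_of_contDiffOn hΘ (hΓ x hx).contDiffOn hθ).hasFDerivAt.sub
      (c.hasFDerivAt.comp θ (differentiableAt_of_contDiffOn hΘ hφ.contDiffOn hθ).hasFDerivAt)
    rwa [hc θ hθ, sub_self] at h2
  have hconst := hΘ.is_const_of_fderiv_eq_zero hM.isPreconnected
    (fun θ hθ => (hdu θ hθ).differentiableAt.differentiableWithinAt)
    (fun θ hθ => (hdu θ hθ).fderiv) hθ hθ₀
  simp only [hct] at hconst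
  linarith

/-! ### From the exponential form to an exponential family -/

theorem IsStatManifold.isFRMExpFamily_of_exponential_form (hM : IsStatManifold μ Θ f)
    {φ : EuclideanSpace ℝ (Fin m) → EuclideanSpace ℝ (Fin m)} {l₀ : E → ℝ}
    {t : E → EuclideanSpace ℝ (Fin m)} {q : EuclideanSpace ℝ (Fin m) → ℝ}
    (hφ : ContDiffOn ℝ ∞ φ Θ) (hunit : ∀ θ ∈ Θ, IsUnit (fderiv ℝ φ θ)) (hl : Measurable l₀)
    (ht : Measurable t) (hq : ContDiffOn ℝ ∞ q Θ)
    (hform : ∀ᵐ x ∂μ, ∀ θ ∈ Θ, logDensity f x θ = l₀ x + pairing (t x) (φ θ) - q θ) :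
    IsFRMExpFamily μ Θ f := by
  have := hM.neZero
  have hΘ := hM.isOpen
  have hf : ∀ᵐ x ∂μ, ∀ θ ∈ Θ, f x θ = Real.exp (-q θ) * Real.exp (l₀ x + pairing (t x) (φ θ)) := by
    filter_upwards [hform, hM.pos] with x hx hp θ hθ
    rw [← Real.exp_add, ← Real.exp_log (hp θ hθ)]
    congr 1
    have := hx θ hθ
    rw [logDensity] at this
    linarith
  -- normalization determines `q`
  have hint : ∀ θ ∈ Θ, Integrable (fun x => Real.exp (l₀ x + pairing (t x) (φ θ))) μ ∧
      Real.log (∫ x, Real.exp (l₀ x + pairing (t x) (φ θ)) ∂μ) = q θ := by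
    intro θ hθ
    have h1 : (fun x => f x θ) =ᵐ[μ]
        fun x => Real.exp (-q θ) * Real.exp (l₀ x + pairing (t x) (φ θ)) := by
      filter_upwards [hf] with x hx using hx θ hθ
    have h2 := (hM.integrable hθ).congr h1
    rw [integrable_const_mul_iff (Real.exp_pos _).ne'.isUnit] at h2
    refine ⟨h2, ?_⟩
    have h3 := hM.integral_eq_one θ hθ
    rw [integral_congr_ae h1, integral_const_mul, Real.exp_neg,
      inv_mul_eq_one₀ (Real.exp_pos _).ne'] at h3
    rw [← h3, Real.log_exp]
  -- parameters with the same image under `φ` give the same density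
  have hinj : Set.InjOn φ Θ := by
    intro θ₁ h₁ θ₂ h₂ h12
    refine hM.identifiable θ₁ h₁ θ₂ h₂ ?_
    have hqq : q θ₁ = q θ₂ := by rw [← (hint θ₁ h₁).2, ← (hint θ₂ h₂).2, h12]
    filter_upwards [hf] with x hx
    rw [hx θ₁ h₁, hx θ₂ h₂, h12, hqq]
  obtain ⟨e, hsource, hcoe, hsymm⟩ :=
    exists_openPartialHomeomorph_of_isUnit_fderiv hΘ hφ hunit hinj
  set ψ : EuclideanSpace ℝ (Fin m) → ℝ :=
    fun ξ => Real.log (∫ x, Real.exp (l₀ x + pairing (t x) ξ) ∂μ)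
  have hψ : ∀ θ ∈ Θ, ψ (φ θ) = q θ := fun θ hθ => (hint θ hθ).2
  have hmaps : Set.MapsTo e.symm e.target Θ := fun ξ hξ => hsource ▸ e.map_target hξ
  have hφsymm : ∀ ξ ∈ e.target, φ (e.symm ξ) = ξ := fun ξ hξ => hcoe ▸ e.right_inv hξ
  have hφtarget : ∀ θ ∈ Θ, φ θ ∈ e.target := fun θ hθ => by
    rw [← hcoe]
    exact e.map_source (hsource ▸ hθ)
  have hψs : ContDiffOn ℝ ∞ ψ e.target :=
    (hq.comp hsymm hmaps).congr fun ξ hξ => by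
      rw [Function.comp_apply, ← hψ _ (hmaps hξ), hφsymm ξ hξ]
  have hder : ∀ᵐ x ∂μ, ∀ θ ∈ Θ, ∀ v, fderiv ℝ (logDensity f x) θ v =
      pairing (t x) (fderiv ℝ φ θ v) - fderiv ℝ q θ v := by
    filter_upwards [hform] with x hx θ hθ v
    rw [(fderiv_of_eq_exponential_form hΘ hφ hq hx).1 θ hθ]
    rfl
  refine ⟨e, l₀, t, ψ, hsource, by rw [hsource, hcoe]; exact hφ, hsymm, hl, ht, hψs, ?_, ?_, ?_,
    ?_⟩
  · have hconv := convexOn_log_integral_exp μ hl ht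
    refine hconv.subset (convexHull_min (fun ξ hξ => ?_) hconv.1) (convex_convexHull ℝ _)
    have h1 := (hint _ (hmaps hξ)).1
    rwa [hφsymm ξ hξ] at h1
  · filter_upwards [hf] with x hx θ hθ
    rw [hx θ hθ, expDensity, hcoe, hψ θ hθ, ← pairing_apply, ← Real.exp_add]
    congr 1
    ring
  · intro a c hac
    obtain ⟨θ, hθ⟩ := hM.nonempty
    obtain ⟨v, hv⟩ := exists_apply_eq_of_isUnit (hunit θ hθ) (WithLp.toLp 2 a)
    have hv0 : v = 0 := by
      refine hM.eq_zero_of_fderiv_logDensity_ae_eq_const hθ (c := c - fderiv ℝ q θ v) ?_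
      filter_upwards [hder, hac] with x hx hcx
      rw [hx θ hθ, hv, pairing_apply, hcx]
    rw [hv0, map_zero] at hv
    ext i
    exact (congrArg (fun w : EuclideanSpace ℝ (Fin m) => w i) hv).symm
  · intro θ hθ a
    obtain ⟨v, hv⟩ := exists_apply_eq_of_isUnit (hunit θ hθ) (EuclideanSpace.single a (1 : ℝ))
    have h1 : (fun x => t x a * f x θ) =ᵐ[μ] fun x =>
        fderiv ℝ (logDensity f x) θ v * f x θ + fderiv ℝ q θ v * f x θ := by
      filter_upwards [hder] with x hx
      rw [hx θ hθ, hv, pairing_apply]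
      simp
      ring
    have hI1 := hM.integrable_fderiv_logDensity hθ v
    have hI2 := (hM.integrable hθ).const_mul (fderiv ℝ q θ v)
    refine ⟨(hI1.add hI2).congr h1.symm, ?_⟩
    rw [expect, integral_congr_ae h1, integral_add hI1 hI2, hM.integral_fderiv_logDensity hθ,
      integral_const_mul, hM.integral_eq_one θ hθ, zero_add, mul_one, pd, hcoe, ← hv]
    have hev : q =ᶠ[nhds θ] ψ ∘ φ := by
      filter_upwards [hΘ.mem_nhds hθ] with θ' hθ' using (hψ θ' hθ').symm
    rw [hev.fderiv_eq, fderiv_comp θ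
      (differentiableAt_of_contDiffOn e.open_target hψs (hφtarget θ hθ))
      (differentiableAt_of_contDiffOn hΘ hφ hθ)]
    rfl

end Equivalence

end StatManifold

theorem theorem3p1 {k m : ℕ} (μ : Measure (EuclideanSpace ℝ (Fin k))) [SigmaFinite μ]
    (Θ : Set (EuclideanSpace ℝ (Fin m)))
    (f : EuclideanSpace ℝ (Fin k) → EuclideanSpace ℝ (Fin m) → ℝ)
    (hM : StatManifold.IsStatManifold μ Θ f) :
    StatManifold.IsFRMExpFamily μ Θ f ↔
      ∀ᵐ x ∂μ, ∀ θ ∈ Θ, ∀ i j : Fin m, StatManifold.eulerSchouten μ f 1 i j x θ = 0 := by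
  refine ⟨fun h => h.eulerSchouten_eq_zero hM, fun h => ?_⟩
  obtain ⟨φ, l₀, t, q, hφ, hunit, hl, ht, hq, hform⟩ := hM.exists_exponential_form h
  exact hM.isFRMExpFamily_of_exponential_form hφ hunit hl ht hq hform
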